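/- Consider a single-server queue with the preemptive last-come, first-served (LCFS) discipline: an arriving packet immediately starts its service and interrupts the ongoing service, if any. Interarrival times are i.i.d., service times are i.i.d., and the two sequences are independent. Each packet carries its arrival time as its time-stamp, and the monitor displays, at time $t$, the newest time-stamp $\eta_t$ among the packets whose service has been completed by time $t$. The age of information (AoI) is $A_t = t - \eta_t$, and the mean AoI is the almost sure long-run time-average $$\mathrm{E}[A] = \lim_{T\to\infty} \frac1T \int_0^T A_t \,\mathrm{d}t \in [0,\infty].$$ Suppose that the service time distribution is absolutely continuous with a probability density function $h$ on $[0,\infty)$ that is bounded and continuous on $[0,\infty)$. For $\lambda > 0$, consider the M/GI/1 queue, with exponentially distributed interarrival times of mean $1/\lambda$, and the D/GI/1 queue, with constant interarrival times $1/\lambda$, both with this service time distribution. Then, for both queues, $\mathrm{E}[A]$ exists in $[0,\infty]$ for every $\lambda > 0$, it is the same for every state of the queue and of the monitor at time $0$, and $$\mathrm{E}[A] \to \frac{1}{h(0)} \qquad (\lambda\to\infty),$$ in the sense that $\mathrm{E}[A]$ converges to the finite value $1/h(0)$ if $h(0)\neq 0$, and $\mathrm{E}[A]$ diverges to infinity if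 $h(0)=0$. -/

import Mathlib

open MeasureTheory ProbabilityTheory Filter Topology
open scoped ENNReal

universe u

noncomputable section

/-- One sample path of the input of a single-server preemptive last-come, first-served queue,
observed on the time axis `[0, ∞)`.  Packets `0, 1, 2, …` are the packets arriving after time `0`.
The first four fields describe the state at time `0`, which may be arbitrary; if the server is idle
at time `0`, take `inServiceAge = initAge`. -/
structure LCFSPath where
  /-- age, at time `0`, of the information then displayed on the monitor -/
  initAge : ℝ
  /-- age, at time `0`, of the packet then in service -/
  inServiceAge : ℝ
  /-- remaining service time, at time `0`, of the packet then in service -/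
  residualService : ℝ
  /-- arrival time of packet `0` -/
  firstArrival : ℝ
  /-- `gap n` is the interarrival time between packet `n` and packet `n + 1` -/
  gap : ℕ → ℝ
  /-- `service n` is the service time of packet `n` -/
  service : ℕ → ℝ

namespace LCFSPath

/-- The arrival time of packet `n`, which is also its time-stamp. -/
def arrival (p : LCFSPath) (n : ℕ) : ℝ :=
  p.firstArrival + ∑ i ∈ Finset.range n, p.gap i

/-- Packet `n` has updated the monitor by time `t`.  Its service starts at its arrival and is
interrupted by the next arrival, so it is informative if and only if its service is completed no
later than that arrival.  (A packet that was overtaken, whether it is discarded or resumed later,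
can only be completed after a newer packet, and so never refreshes the monitor.) -/
def Delivered (p : LCFSPath) (n : ℕ) (t : ℝ) : Prop :=
  p.arrival n + p.service n ≤ p.arrival (n + 1) ∧ p.arrival n + p.service n ≤ t

/-- The packet in service at time `0` has updated the monitor by time `t`. -/
def InitialDelivered (p : LCFSPath) (t : ℝ) : Prop :=
  p.residualService ≤ p.firstArrival ∧ p.residualService ≤ t

/-- The time-stamp of the information displayed at time `t`: the newest of the time-stamps that
have reached the monitor by time `t`. -/
def displayed (p : LCFSPath) (t : ℝ) : ℝ :=
  sSup {x : ℝ | x = -p.initAge ∨ (x = -p.inServiceAge ∧ p.InitialDelivered t) ∨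
    ∃ n, p.Delivered n t ∧ x = p.arrival n}

/-- The age of information at time `t`. -/
def aoi (p : LCFSPath) (t : ℝ) : ℝ := t - p.displayed t

/-- The time-average of the age of information over `[0, T]`. -/
def timeAverage (p : LCFSPath) (T : ℝ) : ℝ≥0∞ :=
  (∫⁻ t in Set.Icc 0 T, ENNReal.ofReal (p.aoi t)) / ENNReal.ofReal T

end LCFSPath

/-- `X` is the random input of a preemptive LCFS GI/GI/1 queue: the interarrival times have law `μ`,
the service times have law `ν`, and all of them are mutually independent.  The state at time `0` may
be random and is arbitrary. -/
structure IsLCFSQueue {Ω : Type*} [MeasurableSpace Ω] (P : Measure Ω) (μ ν : Measure ℝ)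
    (X : Ω → LCFSPath) : Prop where
  gap_law : ∀ n, HasLaw (fun ω => (X ω).gap n) μ P
  service_law : ∀ n, HasLaw (fun ω => (X ω).service n) ν P
  indep : iIndepFun (fun (i : ℕ ⊕ ℕ) (ω : Ω) => Sum.elim (X ω).gap (X ω).service i) P
  initAge_nonneg : ∀ ω, 0 ≤ (X ω).initAge
  inServiceAge_nonneg : ∀ ω, 0 ≤ (X ω).inServiceAge
  residualService_nonneg : ∀ ω, 0 ≤ (X ω).residualService
  firstArrival_nonneg : ∀ ω, 0 ≤ (X ω).firstArrival

/-- `m ∈ [0, ∞]` is the mean AoI `E[A]` of the preemptive LCFS queue with interarrival law `μ` and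
service law `ν`: on every such queue, whatever its state at time `0`, the long-run time-average of
the age of information exists and equals `m` with probability one. -/
def IsMeanAoI (μ ν : Measure ℝ) (m : ℝ≥0∞) : Prop :=
  ∀ (Ω : Type u) (_ : MeasurableSpace Ω) (P : Measure Ω) (_ : IsProbabilityMeasure P)
    (X : Ω → LCFSPath), IsLCFSQueue P μ ν X →
    ∀ᵐ ω ∂P, Tendsto (fun T : ℝ => (X ω).timeAverage T) atTop (𝓝 m)

/-- The law on `[0, ∞)` with density `h`. -/
def densityLaw (h : ℝ → ℝ) : Measure ℝ :=
  (volume.restrict (Set.Ici 0)).withDensity (fun x => ENNReal.ofReal (h x))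

end

/-! Call a packet informative if its service time s is at most the interarrival time g that follows
it; only such packets refresh the monitor. If Z_n is the age just before arrival n, then Z_{n+1} =
g_n + Z_n 1{s_n > g_n}, and between arrivals n and n + 1 the age is a triangle of height g_n plus a
rectangle of height Z_n and width min(s_n, g_n). After the first informative packet this holds
whatever the state at time 0, so the time-average tends to the mean area per packet divided by the
mean interarrival time (`LCFSPath.Regular.tendsto_timeAverage`).

Z_n is a function of the past, hence independent of (g_n, s_n). If p = P(s ≤ g) > 0, the second
moments of Z_n are bounded and the sums of Z_n (c(g_n, s_n) - E c) have orthogonal increments, so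
along the squares c may almost surely be replaced by its mean (`IsInput.ae_tendsto_centered`). When
c is the indicator of s ≤ g, the sum of Z_n c telescopes, and Z averages to E g / p; the choice c =
min(s, g) then gives the mean area. Hence E[A] = E g² / (2 E g) + E min(s, g) / P(s ≤ g), which is
also right, with value ∞, when p = 0 (`isMeanAoI_eq`).

In both queues g = X / λ with the law of X fixed. As λ → ∞ the first term is O(1/λ). Moreover λ E
min(s, X/λ) → E X since s > 0 almost surely, and λ P(s ≤ X/λ) → h(0) E X since the service
distribution function has slope h(0) at the origin. The quotient tends to 1/h(0) in [0, ∞]. -/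

/-- The age of information just before the arrival of packet `n`, when no informative packet
precedes packet `0` and the age at the arrival of packet `0` is counted as `0`. -/
noncomputable def peakAge (g s : ℕ → ℝ) : ℕ → ℝ
  | 0 => 0
  | n + 1 => g n + if s n ≤ g n then 0 else peakAge g s n

/-- The area under the age process contributed between the arrivals of packets `n` and `n + 1`. -/
noncomputable def ageReward (g s : ℕ → ℝ) (n : ℕ) : ℝ :=
  g n ^ 2 / 2 + peakAge g s n * min (s n) (g n)

lemma peakAge_nonneg {g s : ℕ → ℝ} (hg : ∀ n, 0 < g n) (n : ℕ) : 0 ≤ peakAge g s n := by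
  induction n with
  | zero => exact le_rfl
  | succ n ih =>
    have := hg n
    simp only [peakAge]
    split_ifs <;> linarith

/-! ### Pathwise analysis: area under the age process -/

namespace LCFSPath

/-- Regularity of a sample path, which holds almost surely. -/
structure Regular (p : LCFSPath) : Prop where
  gap_pos : ∀ n, 0 < p.gap n
  service_nonneg : ∀ n, 0 ≤ p.service n
  initAge_nonneg : 0 ≤ p.initAge
  inServiceAge_nonneg : 0 ≤ p.inServiceAge
  firstArrival_nonneg : 0 ≤ p.firstArrival

variable {p : LCFSPath}

lemma arrival_succ (p : LCFSPath) (n : ℕ) : p.arrival (n + 1) = p.arrival n + p.gap n := by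
  simp only [arrival, Finset.sum_range_succ]; ring

namespace Regular

lemma strictMono_arrival (hp : p.Regular) : StrictMono p.arrival :=
  strictMono_nat_of_lt_succ fun n => by
    rw [arrival_succ]; linarith [hp.gap_pos n]

lemma arrival_nonneg (hp : p.Regular) (n : ℕ) : 0 ≤ p.arrival n :=
  add_nonneg hp.firstArrival_nonneg (Finset.sum_nonneg fun i _ => (hp.gap_pos i).le)

lemma arrival_le_of_delivered (hp : p.Regular) {n : ℕ} {t : ℝ} (h : p.Delivered n t) :
    p.arrival n ≤ t := by
  have := h.2
  linarith [hp.service_nonneg n]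

lemma displayed_of_delivered (hp : p.Regular) {k : ℕ} {t : ℝ} (hk : p.Delivered k t)
    (hmax : ∀ j, p.Delivered j t → j ≤ k) : p.displayed t = p.arrival k := by
  apply IsGreatest.csSup_eq
  refine ⟨Or.inr (Or.inr ⟨k, hk, rfl⟩), ?_⟩
  rintro x (rfl | ⟨rfl, -⟩ | ⟨j, hj, rfl⟩)
  · linarith [hp.initAge_nonneg, hp.arrival_nonneg k]
  · linarith [hp.inServiceAge_nonneg, hp.arrival_nonneg k]
  · exact hp.strictMono_arrival.monotone (hmax j hj)

lemma neg_initAge_le_displayed (hp : p.Regular) {t : ℝ} (ht : 0 ≤ t) :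
    -p.initAge ≤ p.displayed t := by
  refine le_csSup ⟨t, ?_⟩ (Or.inl rfl)
  rintro x (rfl | ⟨rfl, -⟩ | ⟨j, hj, rfl⟩)
  · linarith [hp.initAge_nonneg]
  · linarith [hp.inServiceAge_nonneg]
  · exact hp.arrival_le_of_delivered hj

lemma delivered_iff {n : ℕ} {t : ℝ} (ht : t < p.arrival (n + 1)) :
    p.Delivered n t ↔ p.arrival n + p.service n ≤ t :=
  ⟨fun h => h.2, fun h => ⟨h.trans ht.le, h⟩⟩

lemma le_of_delivered (hp : p.Regular) {j n : ℕ} {t : ℝ} (ht : t < p.arrival (n + 1))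
    (hj : p.Delivered j t) : j ≤ n :=
  Nat.lt_succ_iff.1 (hp.strictMono_arrival.lt_iff_lt.1 ((hp.arrival_le_of_delivered hj).trans_lt ht))

/-- An informative packet resets the recursion, so beyond `k₀` the conventional value `peakAge 0 =
0` is forgotten and the peak age is the true time since the last informative arrival. -/
lemma exists_last_informative (k₀ : ℕ) (hk₀ : p.service k₀ ≤ p.gap k₀) (n : ℕ) (hn : k₀ < n) :
    ∃ k < n, p.service k ≤ p.gap k ∧ (∀ j, k < j → j < n → p.gap j < p.service j) ∧
      peakAge p.gap p.service n = p.arrival n - p.arrival k := by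
  induction n with
  | zero => omega
  | succ n ih =>
    by_cases h : p.service n ≤ p.gap n
    · refine ⟨n, by omega, h, fun j _ _ => by omega, ?_⟩
      simp [peakAge, h, arrival_succ]
    · have hne : k₀ ≠ n := by rintro rfl; exact h hk₀
      obtain ⟨k, hkn, hk, hlast, heq⟩ := ih (by omega)
      refine ⟨k, by omega, hk, fun j hj hjn => ?_, ?_⟩
      · rcases Nat.lt_succ_iff_lt_or_eq.1 hjn with hj' | rfl
        · exact hlast j hj hj'
        · exact not_le.1 h
      · simp only [peakAge, h, if_false, heq, arrival_succ]; ring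

/-- Until packet `n` completes, the display still shows the last informative packet before it; from
then on it shows packet `n`. If packet `n` is interrupted, the indicator is 1 on the whole interval.
-/
lemma aoi_eq (hp : p.Regular) {k₀ : ℕ} (hk₀ : p.service k₀ ≤ p.gap k₀) {n : ℕ} (hn : k₀ < n)
    {t : ℝ} (ht : t ∈ Set.Ico (p.arrival n) (p.arrival (n + 1))) :
    p.aoi t = (t - p.arrival n) +
      (Set.Iio (p.arrival n + p.service n)).indicator (fun _ => peakAge p.gap p.service n) t := by
  by_cases h : t < p.arrival n + p.service n
  · obtain ⟨k, hkn, hk, hlast, heq⟩ := exists_last_informative k₀ hk₀ n hn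
    have hks : p.arrival k + p.service k ≤ p.arrival (k + 1) := by rw [arrival_succ]; linarith
    have hdel : p.Delivered k t :=
      ⟨hks, (hks.trans (hp.strictMono_arrival.monotone hkn)).trans ht.1⟩
    rw [aoi, hp.displayed_of_delivered hdel, Set.indicator_of_mem (Set.mem_Iio.2 h), heq]
    · ring
    · intro j hj
      by_contra hkj
      have hjn := hp.le_of_delivered ht.2 hj
      rcases hjn.lt_or_eq with hjn | rfl
      · have := hj.1
        rw [arrival_succ] at this
        linarith [hlast j (not_le.1 hkj) hjn]
      · exact absurd hj.2 (not_le.2 h)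
  · rw [Set.indicator_of_notMem (by simpa using h), aoi,
      hp.displayed_of_delivered ((delivered_iff ht.2).2 (not_lt.1 h))
        (fun j hj => hp.le_of_delivered ht.2 hj)]
    ring

lemma lintegral_aoi_Ico (hp : p.Regular) {k₀ : ℕ} (hk₀ : p.service k₀ ≤ p.gap k₀) {n : ℕ}
    (hn : k₀ < n) :
    ∫⁻ t in Set.Ico (p.arrival n) (p.arrival (n + 1)), ENNReal.ofReal (p.aoi t) =
      ENNReal.ofReal (ageReward p.gap p.service n) := by
  set a := p.arrival n
  set Z := peakAge p.gap p.service n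
  have hb : p.arrival (n + 1) = a + p.gap n := arrival_succ p n
  have hg := hp.gap_pos n
  have hs := hp.service_nonneg n
  have hZ : 0 ≤ Z := peakAge_nonneg hp.gap_pos n
  have h1 : ∫⁻ t in Set.Ico a (p.arrival (n + 1)), ENNReal.ofReal (p.aoi t) =
      ∫⁻ t in Set.Ico a (p.arrival (n + 1)), (ENNReal.ofReal (t - a) +
        (Set.Iio (a + p.service n)).indicator (fun _ => ENNReal.ofReal Z) t) := by
    refine setLIntegral_congr_fun measurableSet_Ico fun t ht => ?_
    have hta : 0 ≤ t - a := sub_nonneg.2 ht.1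
    simp only [hp.aoi_eq hk₀ hn ht]
    by_cases h : t ∈ Set.Iio (a + p.service n)
    · rw [Set.indicator_of_mem h, Set.indicator_of_mem h, ENNReal.ofReal_add hta hZ]
    · rw [Set.indicator_of_notMem h, Set.indicator_of_notMem h, add_zero, add_zero]
  have h2 : ∫⁻ t in Set.Ico a (a + p.gap n), ENNReal.ofReal (t - a) =
      ENNReal.ofReal (p.gap n ^ 2 / 2) := by
    rw [← ofReal_integral_eq_lintegral_ofReal]
    · rw [integral_Ico_eq_integral_Ioc, ← intervalIntegral.integral_of_le (by linarith)]
      simp only [intervalIntegral.integral_comp_sub_right (fun x => x), sub_self, integral_id]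
      congr 1; ring
    · exact ((continuous_id.sub continuous_const).integrableOn_Icc).mono_set Set.Ico_subset_Icc_self
    · filter_upwards [ae_restrict_mem measurableSet_Ico] with t ht
      exact sub_nonneg.2 ht.1
  have h3 : Set.Iio (a + p.service n) ∩ Set.Ico a (a + p.gap n) =
      Set.Ico a (a + min (p.service n) (p.gap n)) := by
    ext t
    simp only [Set.mem_inter_iff, Set.mem_Iio, Set.mem_Ico, ← min_add_add_left, lt_min_iff]
    tauto
  rw [h1, hb, lintegral_add_left (by fun_prop), h2, lintegral_indicator_const measurableSet_Iio,
    Measure.restrict_apply measurableSet_Iio, h3, Real.volume_Ico, add_sub_cancel_left,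
    ← ENNReal.ofReal_mul hZ, ← ENNReal.ofReal_add (by positivity) (by positivity)]
  rfl

lemma lintegral_aoi_lt_top (hp : p.Regular) (b : ℝ) :
    ∫⁻ t in Set.Ico 0 b, ENNReal.ofReal (p.aoi t) < ∞ := by
  calc ∫⁻ t in Set.Ico 0 b, ENNReal.ofReal (p.aoi t)
      ≤ ∫⁻ _ in Set.Ico 0 b, ENNReal.ofReal (b + p.initAge) := by
        refine setLIntegral_mono measurable_const fun t ht => ENNReal.ofReal_le_ofReal ?_
        have := hp.neg_initAge_le_displayed ht.1
        have := ht.2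
        rw [aoi]; linarith
    _ < ∞ := by
        rw [setLIntegral_const, Real.volume_Ico]
        exact ENNReal.mul_lt_top ENNReal.ofReal_lt_top ENNReal.ofReal_lt_top

lemma ageReward_nonneg (hp : p.Regular) (n : ℕ) : 0 ≤ ageReward p.gap p.service n := by
  have := peakAge_nonneg (s := p.service) hp.gap_pos n
  have := hp.gap_pos n
  have := hp.service_nonneg n
  unfold ageReward
  positivity

/-- Up to an initial cost `K`, the area under the age process is the sum of the rewards. -/
lemma exists_lintegral_aoi_eq (hp : p.Regular) {k₀ : ℕ} (hk₀ : p.service k₀ ≤ p.gap k₀) :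
    ∃ K : ℝ, ∀ N, k₀ < N →
      ∫⁻ t in Set.Ico 0 (p.arrival N), ENNReal.ofReal (p.aoi t) =
        ENNReal.ofReal (K + ∑ n ∈ Finset.range N, ageReward p.gap p.service n) ∧
      0 ≤ K + ∑ n ∈ Finset.range N, ageReward p.gap p.service n := by
  -- The true area up to the arrival after `k₀`. `K` replaces the fictitious rewards up to `k₀` by
  -- it and may be negative, so nonnegativity of the total is carried through the induction.
  set J : ℝ := (∫⁻ t in Set.Ico 0 (p.arrival (k₀ + 1)), ENNReal.ofReal (p.aoi t)).toReal with hJ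
  refine ⟨J - ∑ n ∈ Finset.range (k₀ + 1), ageReward p.gap p.service n, fun N hN => ?_⟩
  induction N, hN using Nat.le_induction with
  | base =>
    rw [sub_add_cancel, hJ, ENNReal.ofReal_toReal (hp.lintegral_aoi_lt_top _).ne]
    exact ⟨rfl, ENNReal.toReal_nonneg⟩
  | succ N hN ih =>
    have hle : p.arrival N ≤ p.arrival (N + 1) := (hp.strictMono_arrival N.lt_succ_self).le
    rw [Finset.sum_range_succ _ N, ← add_assoc]
    refine ⟨?_, add_nonneg ih.2 (hp.ageReward_nonneg N)⟩
    rw [ENNReal.ofReal_add ih.2 (hp.ageReward_nonneg N), ← ih.1,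
      ← hp.lintegral_aoi_Ico hk₀ hN, ← lintegral_union measurableSet_Ico,
      Set.Ico_union_Ico_eq_Ico (hp.arrival_nonneg N) hle]
    rw [Set.disjoint_left]
    intro t ht ht'
    exact absurd ht.2 (not_lt.2 ht'.1)

/-- For T between arrivals N and N + 1, the average lies between R N / `arrival (N + 1)` and R (N +
1) / `arrival N`, and both bounds tend to r / γ. -/
lemma tendsto_timeAverage (hp : p.Regular) {k₀ : ℕ} (hk₀ : p.service k₀ ≤ p.gap k₀)
    {γ r : ℝ} (hγ : 0 < γ)
    (hgap : Tendsto (fun N : ℕ => (∑ n ∈ Finset.range N, p.gap n) / N) atTop (𝓝 γ))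
    (hrew : Tendsto (fun N : ℕ => (∑ n ∈ Finset.range N, ageReward p.gap p.service n) / N)
      atTop (𝓝 r)) :
    Tendsto (fun T : ℝ => p.timeAverage T) atTop (𝓝 (ENNReal.ofReal (r / γ))) := by
  have hcast : Tendsto (fun N : ℕ => (N : ℝ)) atTop atTop := tendsto_natCast_atTop_atTop
  have ha : Tendsto (fun N : ℕ => p.arrival N / N) atTop (𝓝 γ) := by
    have := (tendsto_const_nhds (x := p.firstArrival)).div_atTop hcast |>.add hgap
    rw [zero_add] at this
    exact this.congr fun N => by rw [arrival, add_div]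
  have hatop : Tendsto p.arrival atTop atTop := by
    have := ha.pos_mul_atTop hγ hcast
    refine this.congr' ?_
    filter_upwards [eventually_gt_atTop 0] with N hN
    rw [div_mul_cancel₀]; positivity
  obtain ⟨K, hK⟩ := hp.exists_lintegral_aoi_eq hk₀
  set R : ℕ → ℝ := fun N => K + ∑ n ∈ Finset.range N, ageReward p.gap p.service n with hR
  have hRN : Tendsto (fun N : ℕ => R N / N) atTop (𝓝 r) := by
    have := (tendsto_const_nhds (x := K)).div_atTop hcast |>.add hrew
    rw [zero_add] at this
    exact this.congr fun N => by rw [hR, add_div]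
  have hsucc : Tendsto (fun N : ℕ => ((N + 1 : ℕ) : ℝ) / N) atTop (𝓝 1) := by
    have := (tendsto_const_nhds (x := (1 : ℝ))).div_atTop hcast |>.const_add 1
    rw [add_zero] at this
    refine this.congr' ?_
    filter_upwards [eventually_gt_atTop 0] with N hN
    have : (N : ℝ) ≠ 0 := by positivity
    push_cast; field_simp
  have hlow : Tendsto (fun N => R N / p.arrival (N + 1)) atTop (𝓝 (r / γ)) := by
    have h1 := ((ha.comp (tendsto_add_atTop_nat 1)).mul hsucc)
    rw [mul_one] at h1
    refine (hRN.div h1 hγ.ne').congr' ?_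
    filter_upwards [eventually_gt_atTop 0] with N hN
    have : (N : ℝ) ≠ 0 := by positivity
    have : ((N + 1 : ℕ) : ℝ) ≠ 0 := by positivity
    simp only [Function.comp, Pi.div_apply]
    field_simp
  have hupp : Tendsto (fun N => R (N + 1) / p.arrival N) atTop (𝓝 (r / γ)) := by
    have h1 := ((hRN.comp (tendsto_add_atTop_nat 1)).mul hsucc)
    rw [mul_one] at h1
    refine (h1.div ha hγ.ne').congr' ?_
    filter_upwards [eventually_gt_atTop 0] with N hN
    have : (N : ℝ) ≠ 0 := by positivity
    have : ((N + 1 : ℕ) : ℝ) ≠ 0 := by positivity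
    simp only [Function.comp, Pi.div_apply]
    field_simp
  have hex : ∀ T : ℝ, ∃ N, p.arrival 0 ≤ T → T ∈ Set.Ico (p.arrival N) (p.arrival (N + 1)) := by
    intro T
    by_cases hT : p.arrival 0 ≤ T
    · classical
      have hex : ∃ N, T < p.arrival N := (hatop.eventually_gt_atTop T).exists
      have hpos : Nat.find hex ≠ 0 := fun h0 => by
        have := Nat.find_spec hex
        rw [h0] at this
        linarith
      obtain ⟨m, hm⟩ := Nat.exists_eq_succ_of_ne_zero hpos
      refine ⟨m, fun _ => ⟨not_lt.1 (Nat.find_min hex (by omega)), ?_⟩⟩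
      have := Nat.find_spec hex
      rwa [hm] at this
    · exact ⟨0, fun h => absurd h hT⟩
  choose I hI using hex
  have hItop : Tendsto I atTop atTop := by
    refine tendsto_atTop.2 fun M => ?_
    filter_upwards [eventually_ge_atTop (p.arrival M), eventually_ge_atTop (p.arrival 0)]
      with T hT hT0
    exact Nat.lt_succ_iff.1 (hp.strictMono_arrival.lt_iff_lt.1 (hT.trans_lt (hI T hT0).2))
  refine tendsto_of_tendsto_of_tendsto_of_le_of_le'
    ((ENNReal.continuous_ofReal.tendsto _).comp (hlow.comp hItop))
    ((ENNReal.continuous_ofReal.tendsto _).comp (hupp.comp hItop)) ?_ ?_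
  · filter_upwards [eventually_ge_atTop (p.arrival 0), hItop.eventually_gt_atTop k₀,
      eventually_gt_atTop 0] with T hT hk hT0
    obtain ⟨h1, h2⟩ := hI T hT
    have hpos : 0 < p.arrival (I T + 1) := hT0.trans h2
    simp only [Function.comp, timeAverage]
    rw [ENNReal.ofReal_div_of_pos hpos, ← (hK (I T) hk).1]
    refine ENNReal.div_le_div (lintegral_mono_set fun t ht => ⟨ht.1, (ht.2.trans_le h1).le⟩)
      (ENNReal.ofReal_le_ofReal h2.le)
  · filter_upwards [eventually_ge_atTop (p.arrival 0), hItop.eventually_gt_atTop k₀,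
      eventually_gt_atTop 0] with T hT hk hT0
    obtain ⟨h1, h2⟩ := hI T hT
    have hpos : 0 < p.arrival (I T) :=
      (hp.arrival_nonneg 0).trans_lt (hp.strictMono_arrival (by omega))
    simp only [Function.comp, timeAverage]
    rw [ENNReal.ofReal_div_of_pos hpos, ← (hK (I T + 1) (by omega)).1]
    refine ENNReal.div_le_div (lintegral_mono_set fun t ht => ⟨ht.1, ht.2.trans_lt h2⟩)
      (ENNReal.ofReal_le_ofReal h1)

/-- No packet arriving after time 0 reaches the monitor, so the displayed time-stamp stays
nonpositive and the age at time t is at least t. -/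
lemma tendsto_timeAverage_top (hp : p.Regular) (h : ∀ n, p.gap n < p.service n) :
    Tendsto (fun T : ℝ => p.timeAverage T) atTop (𝓝 ∞) := by
  have hle : ∀ t, 0 ≤ t → t ≤ p.aoi t := by
    intro t _
    have : p.displayed t ≤ 0 := by
      refine csSup_le ⟨_, Or.inl rfl⟩ ?_
      rintro x (rfl | ⟨rfl, -⟩ | ⟨j, hj, rfl⟩)
      · linarith [hp.initAge_nonneg]
      · linarith [hp.inServiceAge_nonneg]
      · have := hj.1
        rw [arrival_succ] at this
        linarith [h j]
    rw [aoi]; linarith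
  -- On [T/2, T] the age is at least T/2, which contributes area T²/4.
  have hlim : Tendsto (fun T : ℝ => ENNReal.ofReal (T / 4)) atTop (𝓝 ∞) :=
    ENNReal.tendsto_ofReal_atTop.comp (tendsto_id.atTop_div_const (by norm_num))
  refine tendsto_of_tendsto_of_tendsto_of_le_of_le' hlim tendsto_const_nhds ?_
    (Eventually.of_forall fun _ => le_top)
  filter_upwards [eventually_gt_atTop 0] with T hT
  rw [timeAverage, ENNReal.le_div_iff_mul_le (by simp [hT]) (by simp),
    ← ENNReal.ofReal_mul (by positivity)]
  calc ENNReal.ofReal (T / 4 * T)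
      = ∫⁻ _ in Set.Icc (T / 2) T, ENNReal.ofReal (T / 2) := by
        rw [setLIntegral_const, Real.volume_Icc, ← ENNReal.ofReal_mul (by positivity)]
        congr 1; ring
    _ ≤ ∫⁻ t in Set.Icc (T / 2) T, ENNReal.ofReal (p.aoi t) := by
        refine setLIntegral_mono' measurableSet_Icc fun t ht => ENNReal.ofReal_le_ofReal ?_
        exact ht.1.trans (hle t (by linarith [ht.1]))
    _ ≤ _ := lintegral_mono_set (Set.Icc_subset_Icc_left (by positivity))

end Regular
end LCFSPath

/-! ### Averages along the squares; positivity of integrals -/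

/-- The average of a nonnegative sequence converges as soon as it does along the squares. -/
lemma tendsto_avg_of_tendsto_avg_sq {f : ℕ → ℝ} (hf : ∀ n, 0 ≤ f n) {l : ℝ}
    (h : Tendsto (fun k : ℕ => (∑ n ∈ Finset.range (k ^ 2), f n) / ((k ^ 2 : ℕ) : ℝ)) atTop (𝓝 l)) :
    Tendsto (fun N : ℕ => (∑ n ∈ Finset.range N, f n) / N) atTop (𝓝 l) := by
  refine tendsto_div_of_monotone_of_exists_subseq_tendsto_div _ l
    (monotone_nat_of_le_succ fun n => ?_) fun a ha =>
    ⟨fun k => k ^ 2, ?_, tendsto_pow_atTop two_ne_zero, h⟩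
  · rw [Finset.sum_range_succ]; linarith [hf n]
  -- Consecutive squares have ratio tending to 1, so monotone partial sums cannot oscillate between
  -- them.
  · have hlim : Tendsto (fun k : ℕ => (1 + 1 / (k : ℝ)) ^ 2) atTop (𝓝 1) := by
      have := ((tendsto_one_div_atTop_nhds_zero_nat (𝕜 := ℝ)).const_add 1).pow 2
      simpa using this
    filter_upwards [hlim.eventually_lt_const ha, eventually_gt_atTop 0] with k hk hk0
    have hk0' : (0 : ℝ) < k := by positivity
    have : (((k + 1) ^ 2 : ℕ) : ℝ) = (1 + 1 / (k : ℝ)) ^ 2 * (k : ℝ) ^ 2 := by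
      push_cast; field_simp
    rw [this]
    push_cast
    gcongr

lemma integral_pos_of_ae_pos {α : Type*} [MeasurableSpace α] {m : Measure α}
    [IsProbabilityMeasure m] {f : α → ℝ} (hf : ∀ᵐ x ∂m, 0 < f x) (hi : Integrable f m) :
    0 < ∫ x, f x ∂m := by
  rw [integral_pos_iff_support_of_nonneg_ae (hf.mono fun _ hx => hx.le) hi, pos_iff_ne_zero]
  intro h0
  have hz : ∀ᵐ x ∂m, x ∉ Function.support f := measure_eq_zero_iff_ae_notMem.1 h0
  obtain ⟨x, hx, hx'⟩ := (hf.and hz).exists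
  exact hx' hx.ne'

/-! ### Stochastic analysis of the peak ages -/

section

variable {Ω : Type*}

/-- The information carried by the first `n` interarrival and service times. -/
abbrev history (g s : ℕ → Ω → ℝ) (n : ℕ) : MeasurableSpace Ω :=
  ⨆ i ∈ {i : ℕ ⊕ ℕ | Sum.elim id id i < n},
    MeasurableSpace.comap (Sum.elim g s i : Ω → ℝ) inferInstance

/-- `peakAge` as a random variable. -/
noncomputable def peakProc (g s : ℕ → Ω → ℝ) (n : ℕ) (ω : Ω) : ℝ :=
  peakAge (fun k => g k ω) (fun k => s k ω) n

/-- The indicator that a packet with the given interarrival and service time is informative. -/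
noncomputable def informative : ℝ × ℝ → ℝ := {w : ℝ × ℝ | w.2 ≤ w.1}.indicator 1

lemma measurableSet_informative : MeasurableSet {w : ℝ × ℝ | w.2 ≤ w.1} :=
  measurableSet_le measurable_snd measurable_fst

lemma measurable_informative : Measurable informative :=
  measurable_one.indicator measurableSet_informative

lemma informative_nonneg (w : ℝ × ℝ) : 0 ≤ informative w :=
  Set.indicator_nonneg (fun _ _ => zero_le_one) w

lemma informative_le_one (w : ℝ × ℝ) : informative w ≤ 1 :=
  Set.indicator_le_self' (fun _ _ => zero_le_one) w

variable {g s : ℕ → Ω → ℝ}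

lemma peakProc_succ (n : ℕ) (ω : Ω) : peakProc g s (n + 1) ω =
    g n ω + (1 - informative (g n ω, s n ω)) * peakProc g s n ω := by
  by_cases h : s n ω ≤ g n ω <;> simp [peakProc, peakAge, informative, h]

lemma history_mono : Monotone (history g s) := fun _ _ h =>
  biSup_mono fun _ hi => lt_of_lt_of_le hi h

lemma measurable_history {n : ℕ} (i : ℕ ⊕ ℕ) (hi : Sum.elim id id i < n) :
    Measurable[history g s n] (Sum.elim g s i : Ω → ℝ) :=
  Measurable.mono (comap_measurable _)
    (le_iSup₂ (f := fun (i : ℕ ⊕ ℕ) (_ : i ∈ {i : ℕ ⊕ ℕ | Sum.elim id id i < n}) =>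
      MeasurableSpace.comap (Sum.elim g s i : Ω → ℝ) inferInstance) i hi) le_rfl

lemma measurable_history_pair {n : ℕ} {c : ℝ × ℝ → ℝ} (hc : Measurable c) :
    Measurable[history g s (n + 1)] (fun ω => c (g n ω, s n ω)) := by
  have h1 : Measurable[history g s (n + 1)] (g n) :=
    measurable_history (.inl n) (Nat.lt_succ_self n)
  have h2 : Measurable[history g s (n + 1)] (s n) :=
    measurable_history (.inr n) (Nat.lt_succ_self n)
  exact hc.comp (h1.prodMk h2)

lemma measurable_history_peakProc (n : ℕ) : Measurable[history g s n] (peakProc g s n) := by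
  induction n with
  | zero => exact measurable_const
  | succ n ih =>
    have h1 : Measurable[history g s (n + 1)] (peakProc g s n) :=
      ih.mono (history_mono n.le_succ) le_rfl
    have h2 : Measurable[history g s (n + 1)] (g n) :=
      measurable_history (.inl n) (Nat.lt_succ_self n)
    have h3 : Measurable[history g s (n + 1)] (fun ω => 1 - informative (g n ω, s n ω)) :=
      measurable_history_pair (measurable_const.sub measurable_informative)
    have : peakProc g s (n + 1) =
        fun ω => g n ω + (1 - informative (g n ω, s n ω)) * peakProc g s n ω :=
      funext fun ω => peakProc_succ n ω
    rw [this]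
    exact h2.add (h3.mul h1)

lemma memLp_informative {μ ν : Measure ℝ} [IsProbabilityMeasure μ] [IsProbabilityMeasure ν] :
    MemLp informative 2 (μ.prod ν) :=
  MemLp.of_bound measurable_informative.aestronglyMeasurable 1 (Eventually.of_forall fun w => by
    rw [Real.norm_of_nonneg (informative_nonneg w)]; exact informative_le_one w)

/-- Domination by the interarrival time makes moments of the service time unnecessary. -/
lemma memLp_min {μ ν : Measure ℝ} [IsProbabilityMeasure ν] (hμ : MemLp id 2 μ)
    (hμ0 : ∀ᵐ x ∂μ, 0 < x) (hν0 : ∀ᵐ y ∂ν, 0 ≤ y) :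
    MemLp (fun w : ℝ × ℝ => min w.2 w.1) 2 (μ.prod ν) := by
  have h1 : MemLp (fun w : ℝ × ℝ => w.1) 2 (μ.prod ν) := hμ.comp_fst ν
  refine h1.mono (by fun_prop) ?_
  have hx : ∀ᵐ w ∂(μ.prod ν), 0 < w.1 := Measure.quasiMeasurePreserving_fst.ae hμ0
  have hy : ∀ᵐ w ∂(μ.prod ν), 0 ≤ w.2 := Measure.quasiMeasurePreserving_snd.ae hν0
  filter_upwards [hx, hy] with w hw1 hw2
  rw [Real.norm_of_nonneg (le_min hw2 hw1.le), Real.norm_of_nonneg hw1.le]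
  exact min_le_right _ _

variable [mΩ : MeasurableSpace Ω] {P : Measure Ω} {μ ν : Measure ℝ}

/-- Random variables whose second moments are summable tend to zero almost surely. -/
lemma ae_tendsto_zero_of_summable_integral_sq {X : ℕ → Ω → ℝ} (hX : ∀ k, MemLp (X k) 2 P)
    {b : ℕ → ℝ} (hb : Summable b) (hXb : ∀ k, ∫ ω, X k ω ^ 2 ∂P ≤ b k) :
    ∀ᵐ ω ∂P, Tendsto (fun k => X k ω) atTop (𝓝 0) := by
  have hmeas : ∀ k, AEMeasurable (fun ω => ENNReal.ofReal (X k ω ^ 2)) P := fun k =>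
    ((hX k).aestronglyMeasurable.aemeasurable.pow_const 2).ennreal_ofReal
  have hfin : ∫⁻ ω, ∑' k, ENNReal.ofReal (X k ω ^ 2) ∂P ≠ ∞ := by
    rw [lintegral_tsum hmeas]
    have hle : ∑' k, ∫⁻ ω, ENNReal.ofReal (X k ω ^ 2) ∂P ≤ ∑' k, ENNReal.ofReal (b k) := by
      refine ENNReal.tsum_le_tsum fun k => ?_
      rw [← ofReal_integral_eq_lintegral_ofReal (hX k).integrable_sq
        (Eventually.of_forall fun ω => sq_nonneg _)]
      exact ENNReal.ofReal_le_ofReal (hXb k)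
    refine ne_top_of_le_ne_top ?_ hle
    exact hb.tsum_ofReal_ne_top
  filter_upwards [ae_lt_top' (AEMeasurable.tsum hmeas) hfin] with ω hω
  have h0 := ENNReal.tendsto_atTop_zero_of_tsum_ne_top hω.ne
  have h1 : Tendsto (fun k => X k ω ^ 2) atTop (𝓝 0) := by
    have := (ENNReal.tendsto_toReal ENNReal.zero_ne_top).comp h0
    simp only [ENNReal.toReal_zero] at this
    exact this.congr fun k => ENNReal.toReal_ofReal (sq_nonneg _)
  have h2 : Tendsto (fun k => |X k ω|) atTop (𝓝 0) := by
    have := h1.sqrt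
    simpa [Real.sqrt_sq_eq_abs] using this
  exact (tendsto_zero_iff_abs_tendsto_zero _).2 h2

/-- Two independent i.i.d. sequences, of interarrival times and of service times. -/
structure IsInput (P : Measure Ω) (μ ν : Measure ℝ) (g s : ℕ → Ω → ℝ) : Prop where
  meas_gap : ∀ n, Measurable (g n)
  meas_service : ∀ n, Measurable (s n)
  gap_law : ∀ n, HasLaw (g n) μ P
  service_law : ∀ n, HasLaw (s n) ν P
  indep : iIndepFun (fun i : ℕ ⊕ ℕ => (Sum.elim g s i : Ω → ℝ)) P

namespace IsInput

lemma measurable_elim (h : IsInput P μ ν g s) (i : ℕ ⊕ ℕ) :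
    Measurable (Sum.elim g s i : Ω → ℝ) := by
  cases i with
  | inl n => exact h.meas_gap n
  | inr n => exact h.meas_service n

lemma history_le (h : IsInput P μ ν g s) (n : ℕ) : history g s n ≤ mΩ :=
  iSup₂_le fun i _ => (h.measurable_elim i).comap_le

lemma measurable_peakProc (h : IsInput P μ ν g s) (n : ℕ) : Measurable (peakProc g s n) :=
  (measurable_history_peakProc n).mono (h.history_le n) le_rfl

lemma measurable_pair (h : IsInput P μ ν g s) {c : ℝ × ℝ → ℝ} (hc : Measurable c) (n : ℕ) :
    Measurable (fun ω => c (g n ω, s n ω)) :=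
  hc.comp ((h.meas_gap n).prodMk (h.meas_service n))

/-- A variable determined by the past is independent of the current packet. -/
lemma indepFun_history (h : IsInput P μ ν g s) {n : ℕ} {Y : Ω → ℝ}
    (hY : Measurable[history g s n] Y) {c : ℝ × ℝ → ℝ} (hc : Measurable c) :
    IndepFun Y (fun ω => c (g n ω, s n ω)) P := by
  set m : ℕ ⊕ ℕ → MeasurableSpace Ω := fun i =>
    MeasurableSpace.comap (Sum.elim g s i : Ω → ℝ) inferInstance
  have hdisj : Disjoint {i : ℕ ⊕ ℕ | Sum.elim id id i < n} {i : ℕ ⊕ ℕ | Sum.elim id id i = n} :=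
    Set.disjoint_left.2 fun i hi hi' => (ne_of_lt hi) hi'
  have hind : Indep (⨆ i ∈ {i : ℕ ⊕ ℕ | Sum.elim id id i < n}, m i)
      (⨆ i ∈ {i : ℕ ⊕ ℕ | Sum.elim id id i = n}, m i) P :=
    indep_iSup_of_disjoint (fun i => (h.measurable_elim i).comap_le) h.indep hdisj
  have hcur : ∀ i : ℕ ⊕ ℕ, Sum.elim id id i = n →
      Measurable[⨆ i ∈ {i : ℕ ⊕ ℕ | Sum.elim id id i = n}, m i] (Sum.elim g s i : Ω → ℝ) :=
    fun i hi => Measurable.mono (comap_measurable _)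
      (le_iSup₂ (f := fun (i : ℕ ⊕ ℕ) (_ : i ∈ {i : ℕ ⊕ ℕ | Sum.elim id id i = n}) => m i) i hi)
      le_rfl
  have hpair : Measurable[⨆ i ∈ {i : ℕ ⊕ ℕ | Sum.elim id id i = n}, m i]
      (fun ω => c (g n ω, s n ω)) :=
    hc.comp ((hcur (.inl n) rfl).prodMk (hcur (.inr n) rfl))
  exact (IndepFun_iff_Indep _ _ _).2 (indep_of_indep_of_le_left
    (indep_of_indep_of_le_right hind hpair.comap_le) hY.comap_le)

lemma memLp_gap (h : IsInput P μ ν g s) (hμ : MemLp id 2 μ) (n : ℕ) : MemLp (g n) 2 P := by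
  rw [← (h.gap_law n).map_eq] at hμ
  exact hμ.comp_of_map (h.gap_law n).aemeasurable

lemma ae_pos (h : IsInput P μ ν g s) (hμ0 : ∀ᵐ x ∂μ, 0 < x) (hν0 : ∀ᵐ y ∂ν, 0 ≤ y) :
    ∀ᵐ ω ∂P, ∀ n, 0 < g n ω ∧ 0 ≤ s n ω := by
  refine ae_all_iff.2 fun n => ?_
  rw [← (h.gap_law n).map_eq] at hμ0
  rw [← (h.service_law n).map_eq] at hν0
  filter_upwards [ae_of_ae_map (h.gap_law n).aemeasurable hμ0,
    ae_of_ae_map (h.service_law n).aemeasurable hν0] with ω h1 h2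
  exact ⟨h1, h2⟩

lemma ae_tendsto_avg_gap (h : IsInput P μ ν g s) {f : ℝ → ℝ} (hf : Measurable f)
    (hfi : Integrable f μ) :
    ∀ᵐ ω ∂P, Tendsto (fun N : ℕ => (∑ n ∈ Finset.range N, f (g n ω)) / N) atTop
      (𝓝 (∫ x, f x ∂μ)) := by
  have h0 : ∫ ω, f (g 0 ω) ∂P = ∫ x, f x ∂μ :=
    (h.gap_law 0).integral_comp hf.aestronglyMeasurable
  rw [← h0]
  refine strong_law_ae_real (fun n ω => f (g n ω)) ?_ (fun i j hij => ?_) fun n => ?_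
  · rw [← (h.gap_law 0).map_eq] at hfi
    exact hfi.comp_aemeasurable (h.gap_law 0).aemeasurable
  · have : IndepFun (g i) (g j) P :=
      h.indep.indepFun (i := Sum.inl i) (j := Sum.inl j) (by simpa using hij)
    exact this.comp hf hf
  · exact IdentDistrib.comp ⟨(h.gap_law n).aemeasurable, (h.gap_law 0).aemeasurable,
      (h.gap_law n).map_eq.trans (h.gap_law 0).map_eq.symm⟩ hf

lemma memLp_peakProc (h : IsInput P μ ν g s) (hμ : MemLp id 2 μ) (n : ℕ) :
    MemLp (peakProc g s n) 2 P := by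
  induction n with
  | zero => exact MemLp.zero
  | succ n ih =>
    have : peakProc g s (n + 1) =
        g n + fun ω => (1 - informative (g n ω, s n ω)) * peakProc g s n ω :=
      funext fun ω => peakProc_succ n ω
    rw [this]
    refine (h.memLp_gap hμ n).add (ih.mono ?_ (Eventually.of_forall fun ω => ?_))
    · exact ((measurable_const.sub (h.measurable_pair measurable_informative n)).mul
        (h.measurable_peakProc n)).aestronglyMeasurable
    · rw [norm_mul]
      refine mul_le_of_le_one_left (norm_nonneg _) ?_
      have := informative_nonneg (g n ω, s n ω)
      have := informative_le_one (g n ω, s n ω)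
      rw [Real.norm_of_nonneg] <;> linarith

variable [IsProbabilityMeasure P]

lemma hasLaw_pair (h : IsInput P μ ν g s) (n : ℕ) :
    HasLaw (fun ω => (g n ω, s n ω)) (μ.prod ν) P := by
  have hgs : IndepFun (g n) (s n) P :=
    h.indep.indepFun (i := Sum.inl n) (j := Sum.inr n) (by simp)
  exact (indepFun_iff_hasLaw_prodMk_prod (h.gap_law n) (h.service_law n)).1 hgs

lemma integral_pair (h : IsInput P μ ν g s) {c : ℝ × ℝ → ℝ} (hc : Measurable c) (n : ℕ) :
    ∫ ω, c (g n ω, s n ω) ∂P = ∫ w, c w ∂(μ.prod ν) :=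
  (h.hasLaw_pair n).integral_comp hc.aestronglyMeasurable

lemma memLp_pair (h : IsInput P μ ν g s) {c : ℝ × ℝ → ℝ} (hc : MemLp c 2 (μ.prod ν)) (n : ℕ) :
    MemLp (fun ω => c (g n ω, s n ω)) 2 P := by
  have := h.hasLaw_pair n
  rw [← this.map_eq] at hc
  exact hc.comp_of_map this.aemeasurable

lemma memLp_history_mul_pair (h : IsInput P μ ν g s) {n : ℕ} {Y : Ω → ℝ}
    (hY : Measurable[history g s n] Y) (hY2 : MemLp Y 2 P) {c : ℝ × ℝ → ℝ} (hc : Measurable c)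
    (hc2 : MemLp c 2 (μ.prod ν)) :
    MemLp (fun ω => Y ω * c (g n ω, s n ω)) 2 P ∧
    ∫ ω, (Y ω * c (g n ω, s n ω)) ^ 2 ∂P = (∫ ω, Y ω ^ 2 ∂P) * ∫ w, c w ^ 2 ∂(μ.prod ν) := by
  have hi : IndepFun (fun ω => Y ω ^ 2) (fun ω => c (g n ω, s n ω) ^ 2) P :=
    h.indepFun_history (hY.pow_const 2) (hc.pow_const 2)
  have hc2' := h.memLp_pair hc2 n
  have hYm : Measurable Y := hY.mono (h.history_le n) le_rfl
  have hcm := h.measurable_pair hc n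
  constructor
  · refine (memLp_two_iff_integrable_sq (f := fun ω => Y ω * c (g n ω, s n ω))
      (hYm.mul hcm).aestronglyMeasurable).2 ?_
    simp only [mul_pow]
    exact hi.integrable_mul hY2.integrable_sq hc2'.integrable_sq
  · simp only [mul_pow]
    rw [hi.integral_fun_mul_eq_mul_integral (hYm.pow_const 2).aestronglyMeasurable
      (hcm.pow_const 2).aestronglyMeasurable, h.integral_pair (hc.pow_const 2)]

/-- The increments are orthogonal: each is a past variable times an independent centred one. The
second moments therefore add up and grow only linearly in `N`. -/
lemma centered_sum (h : IsInput P μ ν g s) (hμ : MemLp id 2 μ) {B : ℝ}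
    (hB : ∀ n, ∫ ω, peakProc g s n ω ^ 2 ∂P ≤ B) {c : ℝ × ℝ → ℝ} (hc : Measurable c)
    (hc2 : MemLp c 2 (μ.prod ν)) (hc0 : ∫ w, c w ∂(μ.prod ν) = 0) (N : ℕ) :
    Measurable[history g s N]
      (fun ω => ∑ n ∈ Finset.range N, peakProc g s n ω * c (g n ω, s n ω)) ∧
    MemLp (fun ω => ∑ n ∈ Finset.range N, peakProc g s n ω * c (g n ω, s n ω)) 2 P ∧
    ∫ ω, (∑ n ∈ Finset.range N, peakProc g s n ω * c (g n ω, s n ω)) ^ 2 ∂P ≤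
      N * (B * ∫ w, c w ^ 2 ∂(μ.prod ν)) := by
  induction N with
  | zero => simp
  | succ N ih =>
    obtain ⟨ihm, ihL, ihI⟩ := ih
    simp only [Finset.sum_range_succ]
    set V : Ω → ℝ := fun ω => ∑ n ∈ Finset.range N, peakProc g s n ω * c (g n ω, s n ω)
    have hZm := measurable_history_peakProc (g := g) (s := s) N
    have hZL := h.memLp_peakProc hμ N
    obtain ⟨h1, h2⟩ := h.memLp_history_mul_pair hZm hZL hc hc2
    refine ⟨?_, ihL.add h1, ?_⟩
    · exact (ihm.mono (history_mono N.le_succ) le_rfl).add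
        ((hZm.mono (history_mono N.le_succ) le_rfl).mul (measurable_history_pair hc))
    · have hVZ : Integrable (fun ω => V ω * peakProc g s N ω) P := ihL.integrable_mul hZL
      have hcI : Integrable (fun ω => c (g N ω, s N ω)) P :=
        (h.memLp_pair hc2 N).integrable one_le_two
      have hi : IndepFun (fun ω => V ω * peakProc g s N ω) (fun ω => c (g N ω, s N ω)) P :=
        h.indepFun_history (ihm.mul hZm) hc
      have hcross : Integrable (fun ω => V ω * peakProc g s N ω * c (g N ω, s N ω)) P :=
        hi.integrable_mul hVZ hcI
      -- Both `V` and the current peak age belong to the past, so the mean of `c` factors out.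
      have hcross0 : ∫ ω, V ω * peakProc g s N ω * c (g N ω, s N ω) ∂P = 0 := by
        rw [hi.integral_fun_mul_eq_mul_integral hVZ.aestronglyMeasurable hcI.aestronglyMeasurable,
          h.integral_pair hc, hc0, mul_zero]
      have hadd : Integrable (fun ω => V ω ^ 2 +
          2 * (V ω * peakProc g s N ω * c (g N ω, s N ω))) P :=
        ihL.integrable_sq.add (hcross.const_mul 2)
      have hexp : ∀ ω, (V ω + peakProc g s N ω * c (g N ω, s N ω)) ^ 2 = V ω ^ 2 +
          2 * (V ω * peakProc g s N ω * c (g N ω, s N ω)) +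
          (peakProc g s N ω * c (g N ω, s N ω)) ^ 2 := fun ω => by ring
      have hv : 0 ≤ ∫ w, c w ^ 2 ∂(μ.prod ν) := integral_nonneg fun _ => sq_nonneg _
      calc ∫ ω, (V ω + peakProc g s N ω * c (g N ω, s N ω)) ^ 2 ∂P
          = ∫ ω, V ω ^ 2 ∂P + (∫ ω, peakProc g s N ω ^ 2 ∂P) * ∫ w, c w ^ 2 ∂(μ.prod ν) := by
            simp only [hexp]
            rw [integral_add hadd h1.integrable_sq,
              integral_add ihL.integrable_sq (hcross.const_mul 2), integral_const_mul, hcross0, h2]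
            ring
        _ ≤ N * (B * ∫ w, c w ^ 2 ∂(μ.prod ν)) + B * ∫ w, c w ^ 2 ∂(μ.prod ν) := by
            gcongr
            exact hB N
        _ = ((N + 1 : ℕ) : ℝ) * (B * ∫ w, c w ^ 2 ∂(μ.prod ν)) := by push_cast; ring

variable [IsProbabilityMeasure μ] [IsProbabilityMeasure ν]

/-- The second moments of the peak ages are bounded. -/
lemma exists_integral_peakProc_sq_le (h : IsInput P μ ν g s) (hμ : MemLp id 2 μ)
    (hp : 0 < ∫ w, informative w ∂(μ.prod ν)) :
    ∃ B, 0 ≤ B ∧ ∀ n, ∫ ω, peakProc g s n ω ^ 2 ∂P ≤ B := by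
  set p := ∫ w, informative w ∂(μ.prod ν) with hpdef
  set M := ∫ x, x ^ 2 ∂μ with hM
  have hM0 : 0 ≤ M := integral_nonneg fun x => sq_nonneg _
  -- `B` is the fixed point of b ↦ (1 + 1/p) M + (1 + p)(1 - p) b, a contraction because its slope
  -- is 1 - p².
  set B := (1 + 1 / p) * M / p ^ 2 with hB
  have hB0 : 0 ≤ B := by positivity
  have hBp : B * p ^ 2 = (1 + 1 / p) * M := by rw [hB]; field_simp
  refine ⟨B, hB0, fun n => ?_⟩
  induction n with
  | zero => simpa [peakProc, peakAge] using hB0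
  | succ n ih =>
    have hu : Measurable fun w => 1 - informative w := measurable_const.sub measurable_informative
    have hu2 : MemLp (fun w => 1 - informative w) 2 (μ.prod ν) :=
      (memLp_const 1).sub memLp_informative
    obtain ⟨h1, h2⟩ := h.memLp_history_mul_pair (measurable_history_peakProc n)
      (h.memLp_peakProc hμ n) hu hu2
    have h3 : ∫ w, (1 - informative w) ^ 2 ∂(μ.prod ν) = 1 - p := by
      have : ∀ w, (1 - informative w) ^ 2 = 1 - informative w := fun w => by
        by_cases hw : w ∈ {w : ℝ × ℝ | w.2 ≤ w.1} <;> simp [informative, hw]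
      simp only [this]
      rw [integral_sub (integrable_const _) (memLp_informative.integrable one_le_two)]
      simp [hpdef]
    have h4 : ∫ ω, g n ω ^ 2 ∂P = M :=
      (h.gap_law n).integral_comp (f := fun x => x ^ 2) (by fun_prop)
    rw [h3] at h2
    have hp1 : 0 ≤ 1 - p := by rw [← h3]; exact integral_nonneg fun _ => sq_nonneg _
    calc ∫ ω, peakProc g s (n + 1) ω ^ 2 ∂P
        ≤ ∫ ω, ((1 + 1 / p) * g n ω ^ 2 + (1 + p) *
            (peakProc g s n ω * (1 - informative (g n ω, s n ω))) ^ 2) ∂P := by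
          refine integral_mono (h.memLp_peakProc hμ (n + 1)).integrable_sq
            (((h.memLp_gap hμ n).integrable_sq.const_mul _).add (h1.integrable_sq.const_mul _)) ?_
          intro ω
          simp only [peakProc_succ]
          set x := g n ω
          set y := (1 - informative (x, s n ω)) * peakProc g s n ω with hy
          -- Young's inequality: 2xy ≤ x²/p + p y².
          have hxy : 0 ≤ (x - p * y) ^ 2 / p := by positivity
          have hexp : (x - p * y) ^ 2 / p = 1 / p * x ^ 2 - 2 * (x * y) + p * y ^ 2 := by
            field_simp
            ring
          rw [mul_comm (peakProc g s n ω)]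
          rw [← hy]
          nlinarith
      _ = (1 + 1 / p) * M + (1 + p) * ((∫ ω, peakProc g s n ω ^ 2 ∂P) * (1 - p)) := by
          rw [integral_add ((h.memLp_gap hμ n).integrable_sq.const_mul _)
            (h1.integrable_sq.const_mul _), integral_const_mul, integral_const_mul, h4, h2]
      _ ≤ (1 + 1 / p) * M + (1 + p) * (B * (1 - p)) := by gcongr
      _ = B := by rw [← hBp]; ring

/-- The second moment of the quotient is at most B / n², which is summable. -/
lemma ae_tendsto_peakProc_div (h : IsInput P μ ν g s) (hμ : MemLp id 2 μ)
    (hp : 0 < ∫ w, informative w ∂(μ.prod ν)) :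
    ∀ᵐ ω ∂P, Tendsto (fun n : ℕ => peakProc g s n ω / n) atTop (𝓝 0) := by
  obtain ⟨B, hB0, hB⟩ := h.exists_integral_peakProc_sq_le hμ hp
  refine ae_tendsto_zero_of_summable_integral_sq (X := fun n ω => peakProc g s n ω / n)
    (b := fun n : ℕ => B * (1 / (n : ℝ) ^ 2)) (fun n => ?_)
    ((Real.summable_one_div_nat_pow.2 one_lt_two).mul_left B) fun n => ?_
  · simpa only [div_eq_mul_inv] using (h.memLp_peakProc hμ n).mul_const _
  · simp only [div_pow]
    rw [integral_div, div_eq_mul_one_div]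
    exact mul_le_mul_of_nonneg_right (hB n) (by positivity)

/-- Along the squares, functions of the current packet may be averaged out. -/
lemma ae_tendsto_centered (h : IsInput P μ ν g s) (hμ : MemLp id 2 μ)
    (hp : 0 < ∫ w, informative w ∂(μ.prod ν)) {c : ℝ × ℝ → ℝ} (hc : Measurable c)
    (hc2 : MemLp c 2 (μ.prod ν)) :
    ∀ᵐ ω ∂P, Tendsto (fun k : ℕ =>
      (∑ n ∈ Finset.range (k ^ 2), peakProc g s n ω * c (g n ω, s n ω)) / ((k ^ 2 : ℕ) : ℝ) -
      (∫ w, c w ∂(μ.prod ν)) *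
        ((∑ n ∈ Finset.range (k ^ 2), peakProc g s n ω) / ((k ^ 2 : ℕ) : ℝ))) atTop (𝓝 0) := by
  obtain ⟨B, hB0, hB⟩ := h.exists_integral_peakProc_sq_le hμ hp
  set m := ∫ w, c w ∂(μ.prod ν) with hm
  have hd : Measurable fun w => c w - m := hc.sub_const m
  have hd2 : MemLp (fun w => c w - m) 2 (μ.prod ν) := hc2.sub (memLp_const m)
  have hd0 : ∫ w, (c w - m) ∂(μ.prod ν) = 0 := by
    rw [integral_sub (hc2.integrable one_le_two) (integrable_const _)]
    simp [hm]
  have hV := h.centered_sum hμ hB hd hd2 hd0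
  set v := ∫ w, (c w - m) ^ 2 ∂(μ.prod ν)
  set V : ℕ → Ω → ℝ := fun N ω =>
    ∑ n ∈ Finset.range N, peakProc g s n ω * (c (g n ω, s n ω) - m) with hVdef
  have hVL : ∀ N, MemLp (V N) 2 P := fun N => (hV N).2.1
  have hVI : ∀ N, ∫ ω, V N ω ^ 2 ∂P ≤ N * (B * v) := fun N => (hV N).2.2
  have hlim := ae_tendsto_zero_of_summable_integral_sq (P := P)
    (X := fun k ω => V (k ^ 2) ω * (((k ^ 2 : ℕ) : ℝ))⁻¹)
    (b := fun k : ℕ => (B * v) * (1 / (k : ℝ) ^ 2))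
    (fun k => (hVL (k ^ 2)).mul_const _)
    ((Real.summable_one_div_nat_pow.2 one_lt_two).mul_left _) (fun k => by
      simp only [mul_pow]
      rw [integral_mul_const]
      rcases Nat.eq_zero_or_pos k with rfl | hk
      · simp
      · have hk' : (0 : ℝ) < k := by positivity
        refine (mul_le_mul_of_nonneg_right (hVI (k ^ 2)) (by positivity)).trans (le_of_eq ?_)
        push_cast
        field_simp)
  filter_upwards [hlim] with ω hω
  refine hω.congr fun k => ?_
  simp only [hVdef, mul_sub, Finset.sum_sub_distrib, ← Finset.sum_mul]
  ring

/-- The almost sure behaviour of the input when informative packets exist. -/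
lemma ae_tendsto_reward (h : IsInput P μ ν g s) (hμ : MemLp id 2 μ) (hμ0 : ∀ᵐ x ∂μ, 0 < x)
    (hν0 : ∀ᵐ y ∂ν, 0 ≤ y) (hγ : 0 < ∫ x, x ∂μ) (hp : 0 < ∫ w, informative w ∂(μ.prod ν)) :
    ∀ᵐ ω ∂P, (∀ n, 0 < g n ω ∧ 0 ≤ s n ω) ∧ (∃ k, s k ω ≤ g k ω) ∧
      Tendsto (fun N : ℕ => (∑ n ∈ Finset.range N, g n ω) / N) atTop (𝓝 (∫ x, x ∂μ)) ∧
      Tendsto (fun N : ℕ => (∑ n ∈ Finset.range N,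
        ageReward (fun k => g k ω) (fun k => s k ω) n) / N) atTop
        (𝓝 ((∫ x, x ^ 2 ∂μ) / 2 + (∫ w : ℝ × ℝ, min w.2 w.1 ∂(μ.prod ν)) *
          ((∫ x, x ∂μ) / ∫ w, informative w ∂(μ.prod ν)))) := by
  have hsq : Tendsto (fun k : ℕ => k ^ 2) atTop atTop := tendsto_pow_atTop two_ne_zero
  filter_upwards [h.ae_pos hμ0 hν0, h.ae_tendsto_avg_gap measurable_id (hμ.integrable one_le_two),
    h.ae_tendsto_avg_gap (f := fun x => x ^ 2) (by fun_prop) hμ.integrable_sq,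
    h.ae_tendsto_peakProc_div hμ hp,
    h.ae_tendsto_centered hμ hp measurable_informative memLp_informative,
    h.ae_tendsto_centered hμ hp (c := fun w => min w.2 w.1) (by fun_prop)
      (memLp_min hμ hμ0 hν0)] with ω hpos hgap hgap2 hpeak hinf hmin
  simp only [id] at hgap
  -- Conservation law: age created by elapsed time is either removed by an informative packet or
  -- still present.
  have hcons : ∀ N, ∑ n ∈ Finset.range N, peakProc g s n ω * informative (g n ω, s n ω) =
      ∑ n ∈ Finset.range N, g n ω - peakProc g s N ω := by
    intro N
    induction N with
    | zero => simp [peakProc, peakAge]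
    | succ N ih =>
      rw [Finset.sum_range_succ, Finset.sum_range_succ, ih, peakProc_succ]; ring
  have hconsavg : Tendsto (fun N : ℕ => (∑ n ∈ Finset.range N,
      peakProc g s n ω * informative (g n ω, s n ω)) / (N : ℝ)) atTop (𝓝 (∫ x, x ∂μ)) := by
    have := hgap.sub hpeak
    rw [sub_zero] at this
    exact this.congr fun N => by rw [hcons, sub_div]
  refine ⟨hpos, ?_, hgap, ?_⟩
  -- Without informative packets the averages in `hconsavg` would vanish, whereas their limit is
  -- positive.
  · by_contra! hno
    have hz : ∀ n, informative (g n ω, s n ω) = 0 := fun n =>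
      Set.indicator_of_notMem (by simpa using hno n) _
    simp only [hz, mul_zero, Finset.sum_const_zero, zero_div] at hconsavg
    exact hγ.ne (tendsto_nhds_unique tendsto_const_nhds hconsavg)
  · have hZ : Tendsto (fun k : ℕ => (∑ n ∈ Finset.range (k ^ 2), peakProc g s n ω) /
        ((k ^ 2 : ℕ) : ℝ)) atTop (𝓝 ((∫ x, x ∂μ) / ∫ w, informative w ∂(μ.prod ν))) := by
      have := ((hconsavg.comp hsq).sub hinf).div_const (∫ w, informative w ∂(μ.prod ν))
      rw [sub_zero] at this
      refine this.congr fun k => ?_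
      simp only [Function.comp]
      rw [sub_sub_cancel, mul_div_cancel_left₀ _ hp.ne']
    have hZm := (hmin.add (hZ.const_mul (∫ w : ℝ × ℝ, min w.2 w.1 ∂(μ.prod ν))))
    simp only [sub_add_cancel, zero_add] at hZm
    -- The products are nonnegative, so the limit along the squares extends to all N.
    have hZm' := tendsto_avg_of_tendsto_avg_sq (fun n => mul_nonneg
      (peakAge_nonneg (s := fun k => s k ω) (fun k => (hpos k).1) n)
      (le_min (hpos n).2 (hpos n).1.le)) hZm
    refine ((hgap2.div_const 2).add hZm').congr fun N => ?_
    simp only [ageReward, Finset.sum_add_distrib, ← Finset.sum_div]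
    rw [add_div, div_right_comm]

end IsInput

end

/-! ### Mean age for general interarrival and service laws -/

/-- The almost sure statements about the input of a queue hold for a measurable modification. -/
lemma IsLCFSQueue.exists_isInput {Ω : Type*} [MeasurableSpace Ω] {P : Measure Ω} {μ ν : Measure ℝ}
    {X : Ω → LCFSPath} (hX : IsLCFSQueue P μ ν X) :
    ∃ g s : ℕ → Ω → ℝ, IsInput P μ ν g s ∧
      ∀ᵐ ω ∂P, (X ω).gap = (fun n => g n ω) ∧ (X ω).service = fun n => s n ω := by
  have hg := fun n => (hX.gap_law n).aemeasurable
  have hs := fun n => (hX.service_law n).aemeasurable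
  refine ⟨fun n => (hg n).mk _, fun n => (hs n).mk _, ⟨fun n => (hg n).measurable_mk,
    fun n => (hs n).measurable_mk, fun n => (hX.gap_law n).congr (hg n).ae_eq_mk.symm,
    fun n => (hX.service_law n).congr (hs n).ae_eq_mk.symm, ?_⟩, ?_⟩
  · refine hX.indep.congr fun i => ?_
    cases i with
    | inl n => exact (hg n).ae_eq_mk
    | inr n => exact (hs n).ae_eq_mk
  · filter_upwards [ae_all_iff.2 fun n => (hg n).ae_eq_mk, ae_all_iff.2 fun n => (hs n).ae_eq_mk]
      with ω h1 h2
    exact ⟨funext h1, funext h2⟩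

/-- The probability that a packet is informative. -/
lemma integral_informative {μ ν : Measure ℝ} [IsProbabilityMeasure μ] [IsProbabilityMeasure ν] :
    ∫ w, informative w ∂(μ.prod ν) = (μ.prod ν).real {w : ℝ × ℝ | w.2 ≤ w.1} :=
  integral_indicator_one measurableSet_informative

/-- The mean AoI of the preemptive LCFS GI/GI/1 queue. -/
theorem isMeanAoI_eq {μ ν : Measure ℝ} [IsProbabilityMeasure μ] [IsProbabilityMeasure ν]
    (hμ : MemLp id 2 μ) (hμ0 : ∀ᵐ x ∂μ, 0 < x) (hν0 : ∀ᵐ y ∂ν, 0 < y) :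
    IsMeanAoI.{u} μ ν (ENNReal.ofReal ((∫ x, x ^ 2 ∂μ) / 2 / ∫ x, x ∂μ) +
      ENNReal.ofReal (∫ w : ℝ × ℝ, min w.2 w.1 ∂(μ.prod ν)) /
        (μ.prod ν) {w : ℝ × ℝ | w.2 ≤ w.1}) := by
  intro Ω _ P _ X hX
  obtain ⟨g, s, h, hae⟩ := hX.exists_isInput
  have hν0' : ∀ᵐ y ∂ν, 0 ≤ y := hν0.mono fun _ hy => hy.le
  have hx : ∀ᵐ w ∂(μ.prod ν), 0 < w.1 := Measure.quasiMeasurePreserving_fst.ae hμ0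
  have hy : ∀ᵐ w ∂(μ.prod ν), 0 < w.2 := Measure.quasiMeasurePreserving_snd.ae hν0
  have hγ : 0 < ∫ x, x ∂μ :=
    integral_pos_of_ae_pos hμ0 (hμ.integrable one_le_two)
  have hm : 0 < ∫ w : ℝ × ℝ, min w.2 w.1 ∂(μ.prod ν) := by
    refine integral_pos_of_ae_pos ?_ ((memLp_min hμ hμ0 hν0').integrable one_le_two)
    filter_upwards [hx, hy] with w h1 h2
    exact lt_min h2 h1
  have hreg : ∀ᵐ ω ∂P, (X ω).Regular := by
    filter_upwards [hae, h.ae_pos hμ0 hν0'] with ω hω hpos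
    refine ⟨fun n => ?_, fun n => ?_, hX.initAge_nonneg ω, hX.inServiceAge_nonneg ω,
      hX.firstArrival_nonneg ω⟩
    · rw [hω.1]; exact (hpos n).1
    · rw [hω.2]; exact (hpos n).2
  rcases eq_or_ne ((μ.prod ν) {w : ℝ × ℝ | w.2 ≤ w.1}) 0 with h0 | h0
  -- The numerator is positive, so the quotient by zero is ∞, as required when almost surely no
  -- packet is informative.
  · rw [h0, ENNReal.div_zero (by simpa using hm), add_top]
    have hlt : ∀ᵐ ω ∂P, ∀ n, g n ω < s n ω := by
      refine ae_all_iff.2 fun n => ?_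
      have hl := h.hasLaw_pair n
      have hw : ∀ᵐ w ∂(μ.prod ν), w.1 < w.2 := by
        rw [ae_iff]; simpa only [not_lt] using h0
      rw [← hl.map_eq] at hw
      exact ae_of_ae_map hl.aemeasurable hw
    filter_upwards [hae, hreg, hlt] with ω hω hr hl
    refine hr.tendsto_timeAverage_top fun n => ?_
    rw [hω.1, hω.2]
    exact hl n
  · have hp : 0 < (μ.prod ν).real {w : ℝ × ℝ | w.2 ≤ w.1} :=
      ENNReal.toReal_pos h0 (measure_ne_top _ _)
    have hval : ENNReal.ofReal ((∫ x, x ^ 2 ∂μ) / 2 / ∫ x, x ∂μ) +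
        ENNReal.ofReal (∫ w : ℝ × ℝ, min w.2 w.1 ∂(μ.prod ν)) /
          (μ.prod ν) {w : ℝ × ℝ | w.2 ≤ w.1} =
        ENNReal.ofReal (((∫ x, x ^ 2 ∂μ) / 2 + (∫ w : ℝ × ℝ, min w.2 w.1 ∂(μ.prod ν)) *
          ((∫ x, x ∂μ) / ∫ w, informative w ∂(μ.prod ν))) / ∫ x, x ∂μ) := by
      rw [integral_informative, ← ofReal_measureReal (measure_ne_top _ _),
        ← ENNReal.ofReal_div_of_pos hp, ← ENNReal.ofReal_add (by positivity) (by positivity)]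
      congr 1
      field_simp
    rw [hval]
    filter_upwards [hae, hreg, h.ae_tendsto_reward hμ hμ0 hν0' hγ
      (by rwa [integral_informative])] with ω hω hr hrew
    obtain ⟨-, ⟨k, hk⟩, hgap, hrew⟩ := hrew
    rw [← hω.1, ← hω.2] at hrew
    refine hr.tendsto_timeAverage (k₀ := k) ?_ hγ ?_ hrew
    · rw [hω.1, hω.2]; exact hk
    · rw [hω.1]; exact hgap

/-! ### The service law near the origin -/

section Density

variable {h : ℝ → ℝ}

lemma isProbabilityMeasure_densityLaw
    (h_mass : ∫⁻ x in Set.Ici (0 : ℝ), ENNReal.ofReal (h x) = 1) :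
    IsProbabilityMeasure (densityLaw h) :=
  ⟨by rw [densityLaw, withDensity_apply _ MeasurableSet.univ, Measure.restrict_univ, h_mass]⟩

lemma densityLaw_pos : ∀ᵐ y ∂(densityLaw h), 0 < y := by
  refine (withDensity_absolutelyContinuous _ _).ae_le ?_
  filter_upwards [ae_restrict_mem measurableSet_Ici, ae_restrict_of_ae (Measure.ae_ne volume 0)]
    with y hy hy'
  exact lt_of_le_of_ne hy hy'.symm

lemma densityLaw_Iic (h_nonneg : ∀ x, 0 ≤ x → 0 ≤ h x) (h_cont : ContinuousOn h (Set.Ici 0))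
    {a : ℝ} (ha : 0 ≤ a) :
    densityLaw h (Set.Iic a) = ENNReal.ofReal (∫ y in (0 : ℝ)..a, h y) := by
  rw [densityLaw, withDensity_apply _ measurableSet_Iic, Measure.restrict_restrict measurableSet_Iic,
    Set.inter_comm, Set.Ici_inter_Iic, intervalIntegral.integral_of_le ha,
    ← integral_Icc_eq_integral_Ioc, ofReal_integral_eq_lintegral_ofReal]
  · exact (h_cont.mono Set.Icc_subset_Ici_self).integrableOn_Icc
  · filter_upwards [ae_restrict_mem measurableSet_Icc] with y hy
    exact h_nonneg y hy.1

lemma densityLaw_Iic_le {C : ℝ} (hC : ∀ x, 0 ≤ x → h x ≤ C) (a : ℝ) :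
    densityLaw h (Set.Iic a) ≤ ENNReal.ofReal C * ENNReal.ofReal a := by
  rw [densityLaw, withDensity_apply _ measurableSet_Iic, Measure.restrict_restrict measurableSet_Iic,
    Set.inter_comm, Set.Ici_inter_Iic]
  calc ∫⁻ y in Set.Icc 0 a, ENNReal.ofReal (h y)
      ≤ ∫⁻ _ in Set.Icc 0 a, ENNReal.ofReal C :=
        setLIntegral_mono measurable_const fun y hy => ENNReal.ofReal_le_ofReal (hC y hy.1)
    _ = _ := by rw [setLIntegral_const, Real.volume_Icc, sub_zero]

/-- The distribution function of the service time has slope `h 0` at the origin. -/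
lemma tendsto_mul_densityLaw_Iic (h_nonneg : ∀ x, 0 ≤ x → 0 ≤ h x)
    (h_cont : ContinuousOn h (Set.Ici 0)) {x : ℝ} (hx : 0 < x) :
    Tendsto (fun lam : ℝ => ENNReal.ofReal lam * densityLaw h (Set.Iic (x * lam⁻¹))) atTop
      (𝓝 (ENNReal.ofReal (h 0 * x))) := by
  -- Continuity of `h` is available only on [0, ∞), hence the one-sided derivative.
  have hderiv : HasDerivWithinAt (fun a => ∫ y in (0 : ℝ)..a, h y) (h 0) (Set.Ici 0) 0 := by
    refine intervalIntegral.integral_hasDerivWithinAt_right (t := Set.Ioi 0) (by simp) ?_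
      ((h_cont 0 Set.self_mem_Ici).mono Set.Ioi_subset_Ici_self)
    exact ⟨Set.Ioi 0, self_mem_nhdsWithin,
      (h_cont.mono Set.Ioi_subset_Ici_self).aestronglyMeasurable measurableSet_Ioi⟩
  rw [hasDerivWithinAt_iff_tendsto_slope, Set.Ici_sdiff_left] at hderiv
  have hto : Tendsto (fun lam : ℝ => x * lam⁻¹) atTop (𝓝[>] 0) := by
    refine tendsto_nhdsWithin_iff.2 ⟨?_, ?_⟩
    · simpa using tendsto_inv_atTop_zero.const_mul x
    · filter_upwards [eventually_gt_atTop 0] with lam hlam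
      exact mul_pos hx (inv_pos.2 hlam)
  refine ((ENNReal.continuous_ofReal.tendsto _).comp
    ((hderiv.comp hto).mul_const x)).congr' ?_
  filter_upwards [eventually_gt_atTop 0] with lam hlam
  have ha : 0 < x * lam⁻¹ := mul_pos hx (inv_pos.2 hlam)
  rw [densityLaw_Iic h_nonneg h_cont ha.le, ← ENNReal.ofReal_mul hlam.le]
  simp only [Function.comp, slope_def_field, intervalIntegral.integral_same]
  congr 1
  generalize ∫ y in (0 : ℝ)..x * lam⁻¹, h y = F
  have hx' := hx.ne'
  rw [sub_zero, sub_zero]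
  field_simp

end Density

/-! ### Limit under scaling of the interarrival times -/

section Limit

variable {ρ ν : Measure ℝ} {h : ℝ → ℝ}

lemma measurable_mul_inv (lam : ℝ) : Measurable fun x : ℝ => x * lam⁻¹ := measurable_id.mul_const _

lemma tendsto_gap_moment_ratio :
    Tendsto (fun lam : ℝ => ENNReal.ofReal ((∫ x, x ^ 2 ∂(ρ.map fun x => x * lam⁻¹)) / 2 /
      ∫ x, x ∂(ρ.map fun x => x * lam⁻¹))) atTop (𝓝 0) := by
  have h0 : Tendsto (fun lam : ℝ => ENNReal.ofReal
      (((∫ x, x ^ 2 ∂ρ) / 2 / ∫ x, x ∂ρ) * lam⁻¹)) atTop (𝓝 0) := by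
    have := (ENNReal.continuous_ofReal.tendsto _).comp
      (tendsto_inv_atTop_zero.const_mul ((∫ x, x ^ 2 ∂ρ) / 2 / ∫ x, x ∂ρ))
    simpa [Function.comp_def] using this
  refine h0.congr' ?_
  filter_upwards [eventually_gt_atTop 0] with lam hlam
  rw [integral_map (measurable_mul_inv lam).aemeasurable (by fun_prop),
    integral_map (measurable_mul_inv lam).aemeasurable (by fun_prop)]
  simp only [mul_pow]
  rw [integral_mul_const, integral_mul_const]
  congr 1
  field_simp

/-- Conditioning on the unscaled interarrival time x leaves λ H(x/λ), with H the service
distribution function. This tends to h(0) x and is dominated by C x, where C bounds `h`. -/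
lemma tendsto_mul_prob_informative (h_nonneg : ∀ x, 0 ≤ x → 0 ≤ h x)
    (h_cont : ContinuousOn h (Set.Ici 0)) (h_bdd : ∃ C : ℝ, ∀ x, 0 ≤ x → h x ≤ C)
    [IsProbabilityMeasure (densityLaw h)] (hρ : Integrable id ρ) (hρ0 : ∀ᵐ x ∂ρ, 0 < x) :
    Tendsto (fun lam : ℝ => ENNReal.ofReal lam *
      ((ρ.map fun x => x * lam⁻¹).prod (densityLaw h)) {w : ℝ × ℝ | w.2 ≤ w.1}) atTop
      (𝓝 (ENNReal.ofReal (h 0) * ENNReal.ofReal (∫ x, x ∂ρ))) := by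
  obtain ⟨C, hC⟩ := h_bdd
  have hmono : Measurable fun x : ℝ => densityLaw h (Set.Iic x) :=
    (Monotone.measurable fun x y hxy => measure_mono (Set.Iic_subset_Iic.2 hxy))
  have hfun : ∀ lam : ℝ, ENNReal.ofReal lam *
      ((ρ.map fun x => x * lam⁻¹).prod (densityLaw h)) {w : ℝ × ℝ | w.2 ≤ w.1} =
      ∫⁻ x, ENNReal.ofReal lam * densityLaw h (Set.Iic (x * lam⁻¹)) ∂ρ := fun lam => by
    have hcomp : Measurable fun x => densityLaw h (Set.Iic (x * lam⁻¹)) :=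
      hmono.comp (measurable_mul_inv lam)
    rw [Measure.prod_apply measurableSet_informative, lintegral_const_mul _ hcomp]
    congr 1
    exact lintegral_map hmono (measurable_mul_inv lam)
  have hlim : ENNReal.ofReal (h 0) * ENNReal.ofReal (∫ x, x ∂ρ) =
      ∫⁻ x, ENNReal.ofReal (h 0 * x) ∂ρ := by
    rw [← ENNReal.ofReal_mul (h_nonneg 0 le_rfl), ← integral_const_mul,
      ofReal_integral_eq_lintegral_ofReal (f := fun x => h 0 * x) (hρ.const_mul _)]
    filter_upwards [hρ0] with x hx
    exact mul_nonneg (h_nonneg 0 le_rfl) hx.le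
  simp only [hfun]
  rw [hlim]
  refine tendsto_lintegral_filter_of_dominated_convergence
    (fun x => ENNReal.ofReal C * ENNReal.ofReal x)
    (Eventually.of_forall fun lam => (hmono.comp (measurable_mul_inv lam)).const_mul _) ?_ ?_ ?_
  · filter_upwards [eventually_gt_atTop 0] with lam hlam
    filter_upwards [hρ0] with x hx
    calc ENNReal.ofReal lam * densityLaw h (Set.Iic (x * lam⁻¹))
        ≤ ENNReal.ofReal lam * (ENNReal.ofReal C * ENNReal.ofReal (x * lam⁻¹)) := by
          gcongr
          exact densityLaw_Iic_le hC _
      _ = ENNReal.ofReal C * ENNReal.ofReal x := by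
          rw [mul_left_comm, ← ENNReal.ofReal_mul hlam.le]
          congr 2
          field_simp
  · rw [lintegral_const_mul _ ENNReal.measurable_ofReal]
    exact ENNReal.mul_ne_top ENNReal.ofReal_ne_top hρ.lintegral_lt_top.ne
  · filter_upwards [hρ0] with x hx
    exact tendsto_mul_densityLaw_Iic h_nonneg h_cont hx

variable [IsProbabilityMeasure ρ]

lemma isProbabilityMeasure_scaled (lam : ℝ) : IsProbabilityMeasure (ρ.map fun x => x * lam⁻¹) :=
  Measure.isProbabilityMeasure_map (measurable_mul_inv lam).aemeasurable

/-- Moving λ inside turns the integrand into min(λ s, x), which is dominated by x and equals x once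
λ ≥ x / s. -/
lemma tendsto_mul_integral_min [IsProbabilityMeasure ν] (hρ : Integrable id ρ)
    (hρ0 : ∀ᵐ x ∂ρ, 0 < x) (hν0 : ∀ᵐ y ∂ν, 0 < y) :
    Tendsto (fun lam : ℝ => ENNReal.ofReal lam *
      ENNReal.ofReal (∫ w : ℝ × ℝ, min w.2 w.1 ∂((ρ.map fun x => x * lam⁻¹).prod ν))) atTop
      (𝓝 (ENNReal.ofReal (∫ x, x ∂ρ))) := by
  have hx : ∀ᵐ w ∂(ρ.prod ν), 0 < w.1 := Measure.quasiMeasurePreserving_fst.ae hρ0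
  have hy : ∀ᵐ w ∂(ρ.prod ν), 0 < w.2 := Measure.quasiMeasurePreserving_snd.ae hν0
  have hlim : Tendsto (fun lam : ℝ => ∫ w : ℝ × ℝ, min (w.2 * lam) w.1 ∂(ρ.prod ν)) atTop
      (𝓝 (∫ w : ℝ × ℝ, w.1 ∂(ρ.prod ν))) := by
    refine tendsto_integral_filter_of_dominated_convergence (fun w => w.1)
      (Eventually.of_forall fun lam => by fun_prop) ?_ (hρ.comp_fst ν) ?_
    · filter_upwards [eventually_gt_atTop 0] with lam hlam
      filter_upwards [hx, hy] with w h1 h2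
      rw [Real.norm_of_nonneg (le_min (by positivity) h1.le)]
      exact min_le_right _ _
    · filter_upwards [hx, hy] with w h1 h2
      refine tendsto_const_nhds.congr' ?_
      filter_upwards [eventually_ge_atTop (w.1 / w.2)] with lam hlam
      rw [div_le_iff₀ h2] at hlam
      rw [min_eq_right (by linarith)]
  rw [integral_fun_fst (fun x : ℝ => x)] at hlim
  simp only [probReal_univ, one_smul] at hlim
  refine ((ENNReal.continuous_ofReal.tendsto _).comp hlim).congr' ?_
  filter_upwards [eventually_gt_atTop 0] with lam hlam
  have hprod : (ρ.map fun x => x * lam⁻¹).prod ν =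
      (ρ.prod ν).map (Prod.map (fun x => x * lam⁻¹) id) := by
    rw [← Measure.map_prod_map _ _ (measurable_mul_inv lam) measurable_id, Measure.map_id]
  rw [hprod, integral_map ((measurable_mul_inv lam).prodMap measurable_id).aemeasurable
    (by fun_prop), ← ENNReal.ofReal_mul hlam.le, ← integral_const_mul]
  simp only [Function.comp, Prod.map_fst, Prod.map_snd, id]
  congr 2
  ext w
  rw [mul_min_of_nonneg _ _ hlam.le]
  congr 1
  · ring
  · field_simp

/-- The mean AoI when the interarrival times are scaled by `lam⁻¹`, and its limit. -/
theorem exists_meanAoI_scaled (h_nonneg : ∀ x, 0 ≤ x → 0 ≤ h x)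
    (h_cont : ContinuousOn h (Set.Ici 0)) (h_bdd : ∃ C : ℝ, ∀ x, 0 ≤ x → h x ≤ C)
    (h_mass : ∫⁻ x in Set.Ici (0 : ℝ), ENNReal.ofReal (h x) = 1)
    (hρ : MemLp id 2 ρ) (hρ0 : ∀ᵐ x ∂ρ, 0 < x) :
    ∃ EA : ℝ → ℝ≥0∞,
      (∀ lam : ℝ, 0 < lam →
        IsMeanAoI.{u} (ρ.map fun x => x * lam⁻¹) (densityLaw h) (EA lam)) ∧
      Tendsto EA atTop (𝓝 (ENNReal.ofReal (h 0))⁻¹) := by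
  have := isProbabilityMeasure_densityLaw h_mass
  have hρ1 : Integrable id ρ := hρ.integrable one_le_two
  have hEX : 0 < ∫ x, x ∂ρ := integral_pos_of_ae_pos hρ0 hρ1
  have hEX' : ENNReal.ofReal (∫ x, x ∂ρ) ≠ 0 := by simpa using hEX
  refine ⟨fun lam =>
    ENNReal.ofReal ((∫ x, x ^ 2 ∂(ρ.map fun x => x * lam⁻¹)) / 2 /
      ∫ x, x ∂(ρ.map fun x => x * lam⁻¹)) +
    ENNReal.ofReal (∫ w : ℝ × ℝ, min w.2 w.1 ∂((ρ.map fun x => x * lam⁻¹).prod (densityLaw h))) /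
      ((ρ.map fun x => x * lam⁻¹).prod (densityLaw h)) {w : ℝ × ℝ | w.2 ≤ w.1},
    fun lam hlam => ?_, ?_⟩
  · have := isProbabilityMeasure_scaled (ρ := ρ) lam
    have hm := (measurable_mul_inv lam).aemeasurable (μ := ρ)
    refine isMeanAoI_eq ?_ ?_ densityLaw_pos
    · rw [memLp_map_measure_iff (by fun_prop) hm]
      exact hρ.mul_const _
    · rw [ae_map_iff hm measurableSet_Ioi]
      filter_upwards [hρ0] with x hx
      exact mul_pos hx (inv_pos.2 hlam)
  -- The limit of the denominator is zero when h(0) = 0; the nonzero limit of the numerator then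
  -- makes the quotient tend to ∞.
  · have hdiv := ENNReal.Tendsto.div
      (tendsto_mul_integral_min (ν := densityLaw h) hρ1 hρ0 densityLaw_pos)
      (Or.inl hEX') (tendsto_mul_prob_informative h_nonneg h_cont h_bdd hρ1 hρ0)
      (Or.inr ENNReal.ofReal_ne_top)
    have hval : ENNReal.ofReal (∫ x, x ∂ρ) / (ENNReal.ofReal (h 0) * ENNReal.ofReal (∫ x, x ∂ρ)) =
        (ENNReal.ofReal (h 0))⁻¹ := by
      have := ENNReal.mul_div_mul_right 1 (ENNReal.ofReal (h 0)) hEX' ENNReal.ofReal_ne_top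
      rwa [one_mul, one_div] at this
    rw [hval] at hdiv
    have hsum := (tendsto_gap_moment_ratio (ρ := ρ)).add hdiv
    rw [zero_add] at hsum
    refine hsum.congr' ?_
    filter_upwards [eventually_gt_atTop 0] with lam hlam
    rw [ENNReal.mul_div_mul_left _ _ (by simpa using hlam) ENNReal.ofReal_ne_top]

end Limit

/-! ### Exponential and constant interarrival times -/

lemma expMeasure_pos {r : ℝ} (hr : 0 < r) : ∀ᵐ x ∂(expMeasure r), 0 < x := by
  have := isProbabilityMeasure_expMeasure hr
  have h0 : (expMeasure r).real (Set.Iic 0) = 0 := by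
    rw [← cdf_eq_real, cdf_expMeasure_eq hr]; simp
  rw [ae_iff]
  simp only [not_lt]
  exact (measureReal_eq_zero_iff (measure_ne_top _ _)).1 h0

lemma memLp_expMeasure_one : MemLp id 2 (expMeasure 1) := by
  rw [memLp_two_iff_integrable_sq measurable_id.aestronglyMeasurable]
  rw [expMeasure, gammaMeasure, integrable_withDensity_iff_integrable_smul' (f := gammaPDF 1 1)
    (measurable_gammaPDFReal 1 1).ennreal_ofReal
    (Eventually.of_forall fun _ => ENNReal.ofReal_lt_top)]
  -- The second moment is the Gamma integral at 3, with integrand x² e^{-x}.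
  have hint := Real.GammaIntegral_convergent (s := 3) (by norm_num)
  rw [← integrable_indicator_iff measurableSet_Ioi] at hint
  refine hint.congr ?_
  filter_upwards [Measure.ae_ne volume 0] with x hx0
  change _ = (exponentialPDF 1 x).toReal • x ^ 2
  rcases lt_or_gt_of_ne hx0 with hx | hx
  · rw [Set.indicator_of_notMem (by simpa using hx.le), exponentialPDF_of_neg hx]
    simp
  · rw [Set.indicator_of_mem (Set.mem_Ioi.2 hx), exponentialPDF_of_nonneg hx.le,
      ENNReal.toReal_ofReal (by positivity)]
    norm_num

lemma map_expMeasure_one {lam : ℝ} (hlam : 0 < lam) :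
    (expMeasure 1).map (fun x => x * lam⁻¹) = expMeasure lam := by
  have := isProbabilityMeasure_expMeasure one_pos
  have := isProbabilityMeasure_expMeasure hlam
  have := isProbabilityMeasure_scaled (ρ := expMeasure 1) lam
  refine Measure.eq_of_cdf _ _ (StieltjesFunction.ext fun x => ?_)
  have hpre : (fun x => x * lam⁻¹) ⁻¹' Set.Iic x = Set.Iic (lam * x) := by
    ext y
    simp only [Set.mem_preimage, Set.mem_Iic, ← div_eq_mul_inv]
    rw [div_le_iff₀' hlam]
  rw [cdf_eq_real, map_measureReal_apply (measurable_mul_inv lam) measurableSet_Iic, hpre,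
    ← cdf_eq_real, cdf_expMeasure_eq one_pos, cdf_expMeasure_eq hlam]
  simp [mul_nonneg_iff_of_pos_left hlam]

theorem theorem12 (h : ℝ → ℝ)
    (h_nonneg : ∀ x, 0 ≤ x → 0 ≤ h x)
    (h_cont : ContinuousOn h (Set.Ici 0))
    (h_bdd : ∃ C : ℝ, ∀ x, 0 ≤ x → h x ≤ C)
    (h_mass : ∫⁻ x in Set.Ici (0 : ℝ), ENNReal.ofReal (h x) = 1) :
    (∃ EA : ℝ → ℝ≥0∞,
      (∀ lam : ℝ, 0 < lam → IsMeanAoI.{u} (expMeasure lam) (densityLaw h) (EA lam)) ∧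
      Tendsto EA atTop (𝓝 (ENNReal.ofReal (h 0))⁻¹)) ∧
    (∃ EA : ℝ → ℝ≥0∞,
      (∀ lam : ℝ, 0 < lam → IsMeanAoI.{u} (Measure.dirac lam⁻¹) (densityLaw h) (EA lam)) ∧
      Tendsto EA atTop (𝓝 (ENNReal.ofReal (h 0))⁻¹)) := by
  constructor
  · have := isProbabilityMeasure_expMeasure one_pos
    obtain ⟨EA, hEA, hlim⟩ := exists_meanAoI_scaled.{u} h_nonneg h_cont h_bdd h_mass
      memLp_expMeasure_one (expMeasure_pos one_pos)
    refine ⟨EA, fun lam hlam => ?_, hlim⟩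
    rw [← map_expMeasure_one hlam]
    exact hEA lam hlam
  · obtain ⟨EA, hEA, hlim⟩ := exists_meanAoI_scaled.{u} (ρ := Measure.dirac 1) h_nonneg h_cont
      h_bdd h_mass (MemLp.of_bound (by fun_prop) 1 (by simp)) (by simp)
    refine ⟨EA, fun lam hlam => ?_, hlim⟩
    have := hEA lam hlam
    rwa [Measure.map_dirac' (measurable_mul_inv lam), one_mul] at this
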